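/- For a group $G$ and $x\in G$, let $\mathrm{nil}_G(x)=\{g\in G : \langle x,g\rangle \text{ is nilpotent}\}$, and call $G$ an $\mathfrak{n}$-group if $\mathrm{nil}_G(x)$ is a subgroup of $G$ for every $x\in G$. Let $q$ be a prime power with $q^2\not\equiv 1 \pmod{16}$, and let $G=\mathrm{PSL}(2,q)$ be the projective special linear group of degree $2$ over the field with $q$ elements. Then $G$ is an $\mathfrak{n}$-group. Moreover, $\mathrm{nil}_G(a)=C_G(a)$ for every nontrivial element $a\in G$, where $C_G(a)$ is the centralizer of $a$ in $G$. -/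

import Mathlib

/-- The nilpotentizer of `x` in `G`: all `g` such that `⟨x, g⟩` is nilpotent. -/
def nilpotentizer (G : Type*) [Group G] (x : G) : Set G :=
  {g : G | Group.IsNilpotent (Subgroup.closure ({x, g} : Set G))}

/-- An `𝔫`-group: every nilpotentizer is (the underlying set of) a subgroup. -/
def IsNGroup (G : Type*) [Group G] : Prop :=
  ∀ x : G, ∃ H : Subgroup G, (H : Set G) = nilpotentizer G x

open scoped commutatorElement

/-! Every nilpotent subgroup of `PSL(2, q)` is abelian: it suffices that `⁅u, v⁆` commuting with `u`
and `v` forces `⁅u, v⁆ = 1`. Lift to `SL₂`: `Z = ⁅U, V⁆` commutes with `U` and `V` up to sign. If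
`Z` is non-scalar and both signs are `+`, then `U` and `V` are polynomials in `Z`, so they commute
and `Z = 1`. A sign `-` gives `Z ^ 2 = -1` and, by `exists_two_mul_sq_eq_one`, a solution of `2 * a
^ 2 = 1`. Then `2` is a square, so `q ≡ ±1` mod 8 and `q ^ 2 ≡ 1` mod 16. -/

/-- If commutators commuting with both entries are trivial, a nilpotent group is commutative. -/
theorem commute_of_isNilpotent {H : Type*} [Group H] [Group.IsNilpotent H]
    (h : ∀ u v : H, Commute ⁅u, v⁆ u → Commute ⁅u, v⁆ v → Commute u v) (x y : H) :
    Commute x y := by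
  have key : ∀ n, Subgroup.upperCentralSeries H n ≤ Subgroup.center H := by
    intro n
    induction n with
    | zero => simp
    | succ n ih =>
      intro u hu
      rw [Subgroup.mem_center_iff]
      intro v
      have hc : ⁅u, v⁆ ∈ Subgroup.center H :=
        ih (Subgroup.mem_upperCentralSeries_succ_iff.1 hu v)
      rw [Subgroup.mem_center_iff] at hc
      exact (h u v (hc u).symm (hc v).symm).symm
  obtain ⟨n, hn⟩ := Group.IsNilpotent.nilpotent H
  have hx : x ∈ Subgroup.center H := key n (hn ▸ Subgroup.mem_top x)
  exact ((Subgroup.mem_center_iff.1 hx) y).symm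

theorem mem_nilpotentizer_of_commute {G : Type*} [Group G] {x g : G} (h : Commute x g) :
    g ∈ nilpotentizer G x := by
  have hc : ∀ a ∈ ({x, g} : Set G), ∀ b ∈ ({x, g} : Set G), a * b = b * a := by
    rintro a (rfl | rfl) b (rfl | rfl)
    · rfl
    · exact h
    · exact h.symm
    · rfl
  have := Subgroup.isMulCommutative_closure hc
  let : CommGroup (Subgroup.closure ({x, g} : Set G)) :=
    { mul_comm := fun a b => mul_comm' a b }
  exact CommGroup.isNilpotent

theorem nilpotentizer_eq_centralizer {G : Type*} [Group G]
    (h : ∀ u v : G, Commute ⁅u, v⁆ u → Commute ⁅u, v⁆ v → Commute u v) (a : G) :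
    nilpotentizer G a = (Subgroup.centralizer {a} : Set G) := by
  ext g
  rw [SetLike.mem_coe, Subgroup.mem_centralizer_singleton_iff]
  refine ⟨fun hg => ?_, fun hg => mem_nilpotentizer_of_commute hg.symm⟩
  have : Group.IsNilpotent (Subgroup.closure ({a, g} : Set G)) := hg
  have hsub := commute_of_isNilpotent (H := Subgroup.closure ({a, g} : Set G))
    (fun u v hu hv => by
      have := h u v (congrArg Subtype.val hu) (congrArg Subtype.val hv)
      exact Subtype.ext this)
    ⟨a, Subgroup.subset_closure (by simp)⟩ ⟨g, Subgroup.subset_closure (by simp)⟩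
  have := congrArg Subtype.val hsub
  exact this.symm

namespace Matrix

variable {F : Type*} [Field F]

/-- A `2 × 2` matrix commuting with a non-scalar matrix `Z` is a polynomial in `Z`. -/
theorem exists_eq_smul_one_add_smul_of_commute {Z U : Matrix (Fin 2) (Fin 2) F}
    (hZ : ∀ r : F, Z ≠ r • 1) (h : Z * U = U * Z) : ∃ a b : F, U = a • 1 + b • Z := by
  have e : ∀ i j, (Z * U) i j = (U * Z) i j := fun i j => by rw [h]
  have e00 := e 0 0
  have e01 := e 0 1
  have e10 := e 1 0
  simp only [mul_apply, Fin.sum_univ_two] at e00 e01 e10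
  by_cases h01 : Z 0 1 = 0
  · by_cases h10 : Z 1 0 = 0
    · have hd : Z 0 0 - Z 1 1 ≠ 0 := by
        intro hd
        apply hZ (Z 0 0)
        ext i j
        fin_cases i <;> fin_cases j <;> simp [h01, h10]
        linear_combination -hd
      have u01 : U 0 1 = 0 := by
        apply mul_left_cancel₀ hd
        linear_combination e01 - (U 1 1 - U 0 0) * h01
      have u10 : U 1 0 = 0 := by
        apply mul_left_cancel₀ hd
        linear_combination -e10 - (U 1 1 - U 0 0) * h10
      refine ⟨U 0 0 - (U 0 0 - U 1 1) / (Z 0 0 - Z 1 1) * Z 0 0,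
        (U 0 0 - U 1 1) / (Z 0 0 - Z 1 1), ?_⟩
      ext i j
      fin_cases i <;> fin_cases j <;> simp [h01, h10, u01, u10]
      field_simp
      ring
    · refine ⟨U 0 0 - U 1 0 / Z 1 0 * Z 0 0, U 1 0 / Z 1 0, ?_⟩
      ext i j
      fin_cases i <;> fin_cases j <;> simp [h10]
      · field_simp
        linear_combination -e00
      · field_simp
        linear_combination -e10
  · refine ⟨U 0 0 - U 0 1 / Z 0 1 * Z 0 0, U 0 1 / Z 0 1, ?_⟩
    ext i j
    fin_cases i <;> fin_cases j <;> simp [h01]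
    · field_simp
      linear_combination e00
    · field_simp
      linear_combination e01

theorem mul_comm_of_commute_nonscalar {Z U V : Matrix (Fin 2) (Fin 2) F}
    (hZ : ∀ r : F, Z ≠ r • 1) (hU : Z * U = U * Z) (hV : Z * V = V * Z) : U * V = V * U := by
  obtain ⟨a, b, rfl⟩ := exists_eq_smul_one_add_smul_of_commute hZ hU
  simp only [add_mul, mul_add, smul_mul_assoc, mul_smul_comm, one_mul, mul_one, hV]

/-- Conjugation by `U` preserves the trace but sends `Z` to `-Z`. -/
theorem trace_eq_zero_of_anticommute (h2 : (2 : F) ≠ 0) {Z U : Matrix (Fin 2) (Fin 2) F}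
    (dU : U.det = 1) (h : Z * U = -(U * Z)) : Z.trace = 0 := by
  have hadj : U * U.adjugate = 1 := by rw [mul_adjugate, dU, one_smul]
  have h1 : Z.trace = -Z.trace := by
    calc Z.trace = (Z * U * U.adjugate).trace := by rw [mul_assoc, hadj, mul_one]
      _ = -(U * Z * U.adjugate).trace := by rw [h, neg_mul, trace_neg]
      _ = -Z.trace := by
        rw [trace_mul_comm, ← mul_assoc, adjugate_mul, dU, one_smul, one_mul]
  have h3 : (2 : F) * Z.trace = 0 := by linear_combination h1
  exact (mul_eq_zero.1 h3).resolve_left h2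

theorem mul_self_eq_neg_one_of_trace_eq_zero {Z : Matrix (Fin 2) (Fin 2) F}
    (dZ : Z.det = 1) (ht : Z.trace = 0) : Z * Z = -1 := by
  rw [trace_fin_two] at ht
  rw [det_fin_two] at dZ
  ext i j
  fin_cases i <;> fin_cases j <;> simp [mul_apply, Fin.sum_univ_two]
  · linear_combination -dZ + Z 0 0 * ht
  · linear_combination Z 0 1 * ht
  · linear_combination Z 1 0 * ht
  · linear_combination -dZ + Z 1 1 * ht

/-- Matrices `U`, `V` whose commutator is `± Z`, where `Z` anticommutes with `U` and commutes
with `V`, produce a square root of `1 / 2`. -/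
theorem exists_two_mul_sq_eq_one (h2 : (2 : F) ≠ 0) {Z U V : Matrix (Fin 2) (Fin 2) F}
    (hZ : ∀ r : F, Z ≠ r • 1) (dZ : Z.det = 1) (dU : U.det = 1) (dV : V.det = 1)
    (hU : Z * U = -(U * Z)) (hV : Z * V = V * Z) {r : F} (hr : r * r = 1)
    (hUV : U * V = r • (Z * (V * U))) : ∃ a : F, 2 * a ^ 2 = 1 := by
  have ht := trace_eq_zero_of_anticommute h2 dU hU
  have hZZ := mul_self_eq_neg_one_of_trace_eq_zero dZ ht
  obtain ⟨a, b, rfl⟩ := exists_eq_smul_one_add_smul_of_commute hZ hV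
  have hadj : U * U.adjugate = 1 := by rw [mul_adjugate, dU, one_smul]
  have hUZ : U * Z = -(Z * U) := by rw [hU, neg_neg]
  have e1 : (a • (1 : Matrix (Fin 2) (Fin 2) F) - b • Z) * U = (r • (a • Z - b • 1)) * U := by
    calc _ = U * (a • 1 + b • Z) := by
          simp only [sub_mul, mul_add, smul_mul_assoc, mul_smul_comm, one_mul, mul_one, hUZ,
            smul_neg]
          rw [sub_eq_add_neg]
      _ = r • (Z * ((a • 1 + b • Z) * U)) := hUV
      _ = _ := by
          rw [← mul_assoc, mul_add, mul_smul_comm, mul_smul_comm, hZZ, mul_one, smul_mul_assoc,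
            smul_neg, sub_eq_add_neg]
  have e2 : a • (1 : Matrix (Fin 2) (Fin 2) F) - b • Z = r • (a • Z - b • 1) := by
    have := congrArg (· * U.adjugate) e1
    simpa only [mul_assoc, hadj, mul_one] using this
  -- `e2` reads `(b + r * a) • Z = (a + r * b) • 1`, and `Z` is not scalar.
  have hb : b + r * a = 0 := by
    by_contra hne
    apply hZ ((a + r * b) / (b + r * a))
    have e3 : (b + r * a) • Z = (a + r * b) • (1 : Matrix (Fin 2) (Fin 2) F) := by
      linear_combination (norm := module) (-1 : F) • e2
    rw [div_eq_inv_mul, mul_smul, ← e3, smul_smul, inv_mul_cancel₀ hne, one_smul]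
  refine ⟨a, ?_⟩
  rw [trace_fin_two] at ht
  rw [det_fin_two] at dZ dV
  simp at dV
  -- `det (a + b Z) = a ^ 2 + b ^ 2`, with `b = -r * a` and `r ^ 2 = 1`.
  linear_combination dV - a * b * ht - b ^ 2 * dZ + (r * a - b) * hb - a ^ 2 * hr

theorem scalar_of_commutator_commute_up_to_sign (h2 : ∀ a : F, 2 * a ^ 2 ≠ 1)
    {Z U V : Matrix (Fin 2) (Fin 2) F} (dZ : Z.det = 1) (dU : U.det = 1) (dV : V.det = 1)
    (hUV : U * V = Z * (V * U)) (hU : Z * U = U * Z ∨ Z * U = -(U * Z))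
    (hV : Z * V = V * Z ∨ Z * V = -(V * Z)) : ∃ r : F, Z = r • 1 := by
  by_contra! hZ
  have hcomm : ¬ (Z * U = U * Z ∧ Z * V = V * Z) := by
    rintro ⟨hU, hV⟩
    have hc := mul_comm_of_commute_nonscalar hZ hU hV
    apply hZ 1
    have hadj : V * U * (V * U).adjugate = 1 := by
      rw [mul_adjugate, det_mul, dU, dV, one_mul, one_smul]
    calc Z = Z * (V * U) * (V * U).adjugate := by rw [mul_assoc, hadj, mul_one]
      _ = (1 : F) • 1 := by rw [← hUV, hc, hadj, one_smul]
  -- In characteristic 2 the signs disappear.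
  by_cases h : (2 : F) = 0
  · have hneg : ∀ A : Matrix (Fin 2) (Fin 2) F, -A = A := fun A => by
      have h1 : (-1 : F) = 1 := by linear_combination -h
      rw [← neg_one_smul F A, h1, one_smul]
    rw [hneg, or_self] at hU hV
    exact hcomm ⟨hU, hV⟩
  rcases hU with hU | hU <;> rcases hV with hV | hV
  · exact hcomm ⟨hU, hV⟩
  -- Swapping `U` and `V` inverts the commutator, and `Z⁻¹ = -Z`.
  · have hZZ := mul_self_eq_neg_one_of_trace_eq_zero dZ (trace_eq_zero_of_anticommute h dV hV)
    obtain ⟨a, ha⟩ := exists_two_mul_sq_eq_one h hZ dZ dV dU hV hU (r := -1) (by ring) (by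
      rw [hUV, ← mul_assoc Z Z, hZZ, neg_one_mul, neg_one_smul, neg_neg])
    exact h2 a ha
  · obtain ⟨a, ha⟩ := exists_two_mul_sq_eq_one h hZ dZ dU dV hU hV (r := 1) (by ring) (by
      rw [hUV, one_smul])
    exact h2 a ha
  -- If both anticommute with `Z`, then `U * V` commutes with it and can replace `V`.
  · obtain ⟨a, ha⟩ := exists_two_mul_sq_eq_one h hZ dZ dU (V := U * V)
      (by rw [det_mul, dU, dV, one_mul]) hU
      (by rw [← mul_assoc, hU, neg_mul, mul_assoc, hV, mul_neg, neg_neg, mul_assoc])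
      (r := -1) (by ring) (by
        conv_lhs => rw [hUV, ← mul_assoc, ← neg_neg (U * Z), ← hU]
        rw [neg_one_smul, neg_mul]
        simp only [mul_assoc])
    exact h2 a ha

namespace ProjectiveSpecialLinearGroup

theorem eq_or_eq_neg_of_mk_eq_mk {A B : SpecialLinearGroup (Fin 2) F}
    (h : (QuotientGroup.mk A : ProjectiveSpecialLinearGroup (Fin 2) F) = QuotientGroup.mk B) :
    (A : Matrix (Fin 2) (Fin 2) F) = B ∨ (A : Matrix (Fin 2) (Fin 2) F) = -B := by
  obtain ⟨r, hr, hs⟩ := SpecialLinearGroup.mem_center_iff.1 (QuotientGroup.eq.1 h.symm)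
  have hA : (A : Matrix (Fin 2) (Fin 2) F) = r • (B : Matrix (Fin 2) (Fin 2) F) := by
    calc (A : Matrix (Fin 2) (Fin 2) F)
        = ((B * (B⁻¹ * A) : SpecialLinearGroup (Fin 2) F) : Matrix (Fin 2) (Fin 2) F) := by
          rw [mul_inv_cancel_left]
      _ = _ := by
          rw [SpecialLinearGroup.coe_mul, ← hs, scalar_apply, ← smul_one_eq_diagonal,
            mul_smul_comm, mul_one]
  rw [Fintype.card_fin, sq, mul_self_eq_one_iff] at hr
  rcases hr with rfl | rfl
  · left; simpa using hA
  · right; simpa using hA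

theorem commute_of_commute_commutator (h2 : ∀ a : F, 2 * a ^ 2 ≠ 1)
    (u v : ProjectiveSpecialLinearGroup (Fin 2) F)
    (hu : Commute ⁅u, v⁆ u) (hv : Commute ⁅u, v⁆ v) : Commute u v := by
  induction u using QuotientGroup.induction_on with | H U => ?_
  induction v using QuotientGroup.induction_on with | H V => ?_
  have hU := eq_or_eq_neg_of_mk_eq_mk (A := ⁅U, V⁆ * U) (B := U * ⁅U, V⁆) hu
  have hV := eq_or_eq_neg_of_mk_eq_mk (A := ⁅U, V⁆ * V) (B := V * ⁅U, V⁆) hv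
  have hUV : U * V = ⁅U, V⁆ * (V * U) := by
    rw [commutatorElement_def]; group
  obtain ⟨r, hr⟩ := scalar_of_commutator_commute_up_to_sign h2
    (⁅U, V⁆ : SpecialLinearGroup (Fin 2) F).2 U.2 V.2
    (congrArg Subtype.val hUV) hU hV
  have hc : ⁅U, V⁆ ∈ Subgroup.center (SpecialLinearGroup (Fin 2) F) := by
    rw [Subgroup.mem_center_iff]
    intro g
    apply Subtype.ext
    change g.1 * (⁅U, V⁆ : SpecialLinearGroup (Fin 2) F).1 =
      (⁅U, V⁆ : SpecialLinearGroup (Fin 2) F).1 * g.1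
    rw [hr, mul_smul_comm, smul_mul_assoc, mul_one, one_mul]
  rw [← commutatorElement_eq_one_iff_commute]
  exact (QuotientGroup.eq_one_iff _).2 hc

end ProjectiveSpecialLinearGroup

end Matrix

theorem two_mul_sq_ne_one_of_card {F : Type*} [Field F] [Finite F]
    (hF : ¬ Nat.card F ^ 2 ≡ 1 [MOD 16]) (a : F) : 2 * a ^ 2 ≠ 1 := by
  have : Fintype F := Fintype.ofFinite F
  rw [Nat.card_eq_fintype_card] at hF
  intro ha
  have h2 : (2 : F) ≠ 0 := fun h => by simp [h] at ha
  -- `(2 * a) ^ 2 = 2 * (2 * a ^ 2) = 2`.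
  have hsq : IsSquare (2 : F) := ⟨2 * a, by linear_combination (-2 : F) * ha⟩
  have hodd : Fintype.card F % 2 = 1 :=
    FiniteField.odd_card_of_char_ne_two fun h => h2 (by
      have := CharP.cast_eq_zero F (ringChar F)
      rw [h] at this
      exact_mod_cast this)
  rw [FiniteField.isSquare_two_iff] at hsq
  apply hF
  have h16 : Fintype.card F % 16 = 1 ∨ Fintype.card F % 16 = 7 ∨ Fintype.card F % 16 = 9 ∨
      Fintype.card F % 16 = 15 := by omega
  rcases h16 with h | h | h | h <;> simp [Nat.ModEq, Nat.pow_mod, h]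

theorem mainTheorem5 (q : ℕ) (hq : IsPrimePow q) (hq16 : ¬ q ^ 2 ≡ 1 [MOD 16])
    (F : Type*) [Field F] [Finite F] (hF : Nat.card F = q) :
    IsNGroup (Matrix.ProjectiveSpecialLinearGroup (Fin 2) F) ∧
      ∀ a : Matrix.ProjectiveSpecialLinearGroup (Fin 2) F, a ≠ 1 →
        nilpotentizer (Matrix.ProjectiveSpecialLinearGroup (Fin 2) F) a =
          (Subgroup.centralizer {a} : Set (Matrix.ProjectiveSpecialLinearGroup (Fin 2) F)) := by
  subst hF
  have h := nilpotentizer_eq_centralizer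
    (Matrix.ProjectiveSpecialLinearGroup.commute_of_commute_commutator
      (two_mul_sq_ne_one_of_card hq16))
  exact ⟨fun x => ⟨_, (h x).symm⟩, fun a _ => h a⟩
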